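/- Let $\mathcal M=\mathbb H/\mathrm{PSL}(2,\mathbb Z)$ be the modular surface with projection $\pi:\mathbb H\to\mathcal M$, let $\mathcal F=\{z\in\mathbb H: 0\le \Re z\le 1,\ |z|\ge 1,\ |z-1|\ge 1\}$, fix a real number $T_0\ge 1$, and let $\mathcal M_c^{T_0}=\pi(\mathcal F\cap\{\Im z\le T_0\})$ be the compact core. A geodesic of $\mathcal M$ is a curve $\gamma=\pi\circ\bar\gamma$, where $\bar\gamma:\mathbb R\to\mathbb H$ is a complete unit-speed hyperbolic geodesic; two such curves are regarded as the same geodesic if they differ by a reparametrization $t\mapsto c\pm t$ (so geodesics are unoriented). A geodesic $\gamma$ is called scattering if $\gamma(t)\notin\mathcal M_c^{T_0}$ for all sufficiently large $|t|$; its sojourn time is the time elapsed from the moment it first enters $\mathcal M_c^{T_0}$ to the moment it leaves $\mathcal M_c^{T_0}$ permanently. For $q\ge 2$ let $I_q=\{p\in\mathbb Z: 1\le p<q,\ \gcd(p,q)=1\}$ and $S_q=\{p\in\mathbb Z: 1\le p<q,\ p^2\equiv -1 \pmod q\}$. For $p\in I_q$ let $y_{p,q}$ be the unique element of $I_q$ with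 $p\,y_{p,q}\equiv -1\pmod q$, let $C_q=\{p\in I_q: p\ne y_{p,q}\}$, and let $C_q^*$ be the set of the numbers $\min\{p_1,p_2\}$, where $p_1\neq p_2$ run over the elements of $C_q$ with $p_1p_2\equiv -1\pmod q$. Put $\mathcal G_1=\{0\}$, $\mathcal G_q=\{p/q : p\in C_q^*\sqcup S_q\}$ for $q\ge 2$, and $\mathcal G=\bigsqcup_{q\ge 1}\mathcal G_q\subset[0,1)\cap\mathbb Q$. Then the map which sends $w\in\mathcal G$ to the projection to $\mathcal M$ of the geodesic of $\mathbb H$ joining $w$ to $\infty$ is a bijection from $\mathcal G$ onto the set of scattering geodesics of $\mathcal M$. Moreover, for every $q\ge 1$ and every $w\in\mathcal G_q$, the scattering geodesic corresponding to $w$ has sojourn time $2\log(qT_0)$. -/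

import Mathlib

open scoped UpperHalfPlane MatrixGroups

noncomputable section

namespace ScatGeod

/-! ### The modular surface and its compact core -/

/-- The modular surface `ℍ / PSL(2, ℤ)`: the space of orbits of `SL(2, ℤ)` acting on the upper half
plane by Möbius transformations (the action factors through `PSL(2, ℤ)`, with the same orbits). -/
abbrev ModularSurface : Type := MulAction.orbitRel.Quotient SL(2, ℤ) ℍ

/-- The canonical projection `π : ℍ → ℍ / PSL(2, ℤ)`. -/
def proj (z : ℍ) : ModularSurface := Quotient.mk (MulAction.orbitRel SL(2, ℤ) ℍ) z

/-- The fundamental domain `{z | 0 ≤ Re z ≤ 1, |z| ≥ 1, |z - 1| ≥ 1}`. -/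
def fundDomain : Set ℍ :=
  {z | 0 ≤ z.re ∧ z.re ≤ 1 ∧ 1 ≤ ‖(z : ℂ)‖ ∧ 1 ≤ ‖(z : ℂ) - 1‖}

/-- The compact core: the image in the modular surface of the part of the fundamental domain
lying at height at most `T₀`. -/
def compactCore (T₀ : ℝ) : Set ModularSurface := proj '' (fundDomain ∩ {z | z.im ≤ T₀})

/-! ### Geodesics of the modular surface -/

/-- Complete unit-speed geodesics of the modular surface: the projections of the complete
unit-speed geodesics of `ℍ`. The latter are the isometric embeddings of the real line into `ℍ`
with its hyperbolic metric. -/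
def ParamGeodesic : Type :=
  {γ : ℝ → ModularSurface // ∃ g : ℝ → ℍ, Isometry g ∧ ∀ t, γ t = proj (g t)}

/-- Two unit-speed geodesics agree up to a change of the unit-speed parametrization, that is up to
a translation of time and possibly a reversal of the orientation. -/
def SameTrack (γ₁ γ₂ : ParamGeodesic) : Prop :=
  ∃ c : ℝ, (∀ t, γ₂.1 t = γ₁.1 (c + t)) ∨ (∀ t, γ₂.1 t = γ₁.1 (c - t))

theorem SameTrack.refl (γ : ParamGeodesic) : SameTrack γ γ :=
  ⟨0, Or.inl fun t => by rw [zero_add]⟩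

theorem SameTrack.symm {γ₁ γ₂ : ParamGeodesic} (h : SameTrack γ₁ γ₂) : SameTrack γ₂ γ₁ := by
  obtain ⟨c, h | h⟩ := h
  · exact ⟨-c, Or.inl fun t => by rw [h]; ring_nf⟩
  · exact ⟨c, Or.inr fun t => by rw [h]; ring_nf⟩

theorem SameTrack.trans {γ₁ γ₂ γ₃ : ParamGeodesic} (h : SameTrack γ₁ γ₂) (h' : SameTrack γ₂ γ₃) :
    SameTrack γ₁ γ₃ := by
  obtain ⟨c, h | h⟩ := h <;> obtain ⟨d, h' | h'⟩ := h'
  · exact ⟨c + d, Or.inl fun t => by rw [h', h]; ring_nf⟩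
  · exact ⟨c + d, Or.inr fun t => by rw [h', h]; ring_nf⟩
  · exact ⟨c - d, Or.inr fun t => by rw [h', h]; ring_nf⟩
  · exact ⟨c - d, Or.inl fun t => by rw [h', h]; ring_nf⟩

instance trackSetoid : Setoid ParamGeodesic where
  r := SameTrack
  iseqv := ⟨SameTrack.refl, SameTrack.symm, SameTrack.trans⟩

/-- A geodesic of the modular surface: a unit-speed geodesic, regardless of its parametrization
and of its orientation. -/
def Geodesic : Type := Quotient trackSetoid

/-! ### Scattering geodesics and sojourn times -/

/-- The geodesic lies outside the compact core for all times of large absolute value. -/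
def ParamGeodesic.IsScattering (T₀ : ℝ) (γ : ParamGeodesic) : Prop :=
  ∃ R : ℝ, ∀ t : ℝ, R ≤ |t| → γ.1 t ∉ compactCore T₀

/-- The geodesic first enters the compact core at some time `a`, leaves it permanently at some
time `b`, and `l = b - a`. -/
def ParamGeodesic.HasSojournTime (T₀ : ℝ) (γ : ParamGeodesic) (l : ℝ) : Prop :=
  ∃ a b : ℝ, IsLeast {t : ℝ | γ.1 t ∈ compactCore T₀} a ∧
    IsGreatest {t : ℝ | γ.1 t ∈ compactCore T₀} b ∧ l = b - a

theorem SameTrack.isScattering {T₀ : ℝ} {γ₁ γ₂ : ParamGeodesic} (h : SameTrack γ₁ γ₂)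
    (h₁ : γ₁.IsScattering T₀) : γ₂.IsScattering T₀ := by
  obtain ⟨R, hR⟩ := h₁
  obtain ⟨c, h | h⟩ := h
  · refine ⟨R + |c|, fun t ht => ?_⟩
    rw [h]
    refine hR _ ?_
    have := abs_sub_abs_le_abs_sub t (-c)
    rw [abs_neg, sub_neg_eq_add, add_comm t c] at this
    linarith
  · refine ⟨R + |c|, fun t ht => ?_⟩
    rw [h]
    refine hR _ ?_
    have := abs_sub_abs_le_abs_sub t c
    rw [abs_sub_comm t c] at this
    linarith

theorem SameTrack.hasSojournTime {T₀ l : ℝ} {γ₁ γ₂ : ParamGeodesic} (h : SameTrack γ₁ γ₂)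
    (h₁ : γ₁.HasSojournTime T₀ l) : γ₂.HasSojournTime T₀ l := by
  obtain ⟨a, b, ⟨ha, ha'⟩, ⟨hb, hb'⟩, rfl⟩ := h₁
  replace ha : γ₁.1 a ∈ compactCore T₀ := ha
  replace hb : γ₁.1 b ∈ compactCore T₀ := hb
  obtain ⟨c, h | h⟩ := h
  · refine ⟨a - c, b - c, ⟨?_, fun t ht => ?_⟩, ⟨?_, fun t ht => ?_⟩, by ring⟩
    · simpa [h] using ha
    · have := ha' (show γ₁.1 (c + t) ∈ compactCore T₀ from h t ▸ ht)
      linarith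
    · simpa [h] using hb
    · have := hb' (show γ₁.1 (c + t) ∈ compactCore T₀ from h t ▸ ht)
      linarith
  · refine ⟨c - b, c - a, ⟨?_, fun t ht => ?_⟩, ⟨?_, fun t ht => ?_⟩, by ring⟩
    · simpa [h] using hb
    · have := hb' (show γ₁.1 (c - t) ∈ compactCore T₀ from h t ▸ ht)
      linarith
    · simpa [h] using ha
    · have := ha' (show γ₁.1 (c - t) ∈ compactCore T₀ from h t ▸ ht)
      linarith

/-- A geodesic of the modular surface is scattering if its parametrizations are. -/
def Geodesic.IsScattering (T₀ : ℝ) : Geodesic → Prop :=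
  Quotient.lift (fun γ => γ.IsScattering T₀) fun _ _ h =>
    propext ⟨SameTrack.isScattering h, SameTrack.isScattering (SameTrack.symm h)⟩

/-- `γ.HasSojournTime T₀ l`: the geodesic `γ` enters the compact core, leaves it permanently, and
the time that elapses from the first entrance to the last exit is `l`. -/
def Geodesic.HasSojournTime (T₀ : ℝ) (γ : Geodesic) (l : ℝ) : Prop :=
  Quotient.lift (fun γ : ParamGeodesic => γ.HasSojournTime T₀ l) (fun _ _ h =>
    propext ⟨SameTrack.hasSojournTime h, SameTrack.hasSojournTime (SameTrack.symm h)⟩) γ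

/-- The set of scattering geodesics of the modular surface. -/
def scatteringGeodesics (T₀ : ℝ) : Set Geodesic := {γ | γ.IsScattering T₀}

/-! ### The geodesics with end points `∞` and `w` -/

/-- The vertical line `t ↦ w + i e^{-t}`, the unit-speed geodesic of `ℍ` from `∞` to `w`. -/
def vertLine (w t : ℝ) : ℍ := UpperHalfPlane.mk ⟨w, Real.exp (-t)⟩ (Real.exp_pos (-t))

theorem isometry_vertLine (w : ℝ) : Isometry (vertLine w) :=
  (UpperHalfPlane.isometry_vertical_line w).comp (IsometryEquiv.neg ℝ).isometry

/-- The geodesic of the modular surface which is the projection of the geodesic of `ℍ` joining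
`w` to `∞`. -/
def geodesicTo (w : ℝ) : Geodesic :=
  Quotient.mk trackSetoid
    ⟨fun t => proj (vertLine w t), vertLine w, isometry_vertLine w, fun _ => rfl⟩

/-! ### The set of rationals -/

/-- The `p` with `1 ≤ p < q` and `gcd (p, q) = 1`. -/
def I (q : ℕ) : Set ℕ := {p | 1 ≤ p ∧ p < q ∧ p.Coprime q}

/-- The `p` with `1 ≤ p < q` and `p² ≡ -1 (mod q)`. -/
def S (q : ℕ) : Set ℕ := {p | 1 ≤ p ∧ p < q ∧ (p : ℤ) ^ 2 ≡ -1 [ZMOD q]}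

/-- The `p ∈ I q` which differ from the (unique) `y ∈ I q` such that `p y ≡ -1 (mod q)`. -/
def C (q : ℕ) : Set ℕ := {p | p ∈ I q ∧ ∃ y ∈ I q, (p : ℤ) * y ≡ -1 [ZMOD q] ∧ p ≠ y}

/-- The smaller members of the pairs `p₁ ≠ p₂` in `C q` with `p₁ p₂ ≡ -1 (mod q)`. -/
def Cstar (q : ℕ) : Set ℕ :=
  {p | ∃ p₁ ∈ C q, ∃ p₂ ∈ C q, p₁ ≠ p₂ ∧ (p₁ : ℤ) * p₂ ≡ -1 [ZMOD q] ∧ p = min p₁ p₂}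

/-- `G 1 = {0}`, and `G q = {p / q | p ∈ Cstar q ∪ S q}` for `q ≥ 2`. -/
def G (q : ℕ) : Set ℚ :=
  if q = 1 then {0} else {w | ∃ p ∈ Cstar q ∪ S q, w = (p : ℚ) / q}

/-- The union of the sets `G q`, `q ≥ 1` (which are pairwise disjoint: for `w ∈ G q`, the
denominator of `w` in lowest terms is `q`). -/
def GAll : Set ℚ := ⋃ q : ℕ, ⋃ _ : 1 ≤ q, G q

end ScatGeod

end

namespace ScatGeod

/-! ### The action of `SL(2, ℤ)` on heights -/

/-! The complement of the core is a union of horoballs: an orbit avoids the core exactly when some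
point of it is higher than `T₀` (`proj_mem_compactCore_iff`). As `T₀ ≥ 1`, horoballs at different
cusps are disjoint, so each end of a scattering geodesic stays in one of them
(`exists_lt_im_smul_of_notMem_compactCore`). Moving the horoball of the past end to `∞` makes the
lift vertical (`eq_vertLine_of_lt_im`); the other end then forces its foot to be rational
(`exists_rat_eq_of_lt_im_smul`).

If `p y ≡ -1 (mod q)`, a modular matrix sends `p/q` to `∞` and `∞` to `y/q`, so the lines over `p/q`
and `y/q` project to the same geodesic with opposite orientations (`proj_vertLine_div`). Together
with integer translations this is the only coincidence, and `GAll` keeps the smaller fraction of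
each pair (`IsReduced`). The core is first met at height `T₀`, at time `-log T₀`; the reversal `t ↦
2 log q - t` turns this into the last exit, whence `2 log (q T₀)`. -/

theorem im_smul_eq (A : SL(2, ℤ)) (z : ℍ) :
    (A • z).im = z.im / (((A 1 0 : ℝ) * z.re + A 1 1) ^ 2 + ((A 1 0 : ℝ) * z.im) ^ 2) := by
  rw [ModularGroup.im_smul_eq_div_normSq, ModularGroup.denom_apply, Complex.normSq_apply]
  simp
  ring_nf

theorem proj_smul (A : SL(2, ℤ)) (z : ℍ) : proj (A • z) = proj z :=
  Quotient.sound ⟨A, rfl⟩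

theorem proj_eq_proj_iff {z w : ℍ} : proj z = proj w ↔ ∃ A : SL(2, ℤ), A • w = z :=
  ⟨fun h => Quotient.exact h, fun ⟨A, h⟩ => h ▸ proj_smul A w⟩

theorem bottom_row_ne_zero (A : SL(2, ℤ)) (hc : A 1 0 = 0) (hd : A 1 1 = 0) : False := by
  have := A.det_coe
  rw [Matrix.det_fin_two, hc, hd] at this
  simp at this

/-- In the strip `|c z + d|² ≥ c² - |c| |d| + d²`, a positive definite integral form, hence at least
`1` on a nonzero bottom row. -/
theorem im_smul_le_of_strip {z : ℍ} (h : 1 ≤ z.re ^ 2 + z.im ^ 2) (h1 : -(1 / 2) ≤ z.re)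
    (h2 : z.re ≤ 1 / 2) (A : SL(2, ℤ)) : (A • z).im ≤ z.im := by
  rw [im_smul_eq]
  refine div_le_self z.im_pos.le ?_
  set c := A 1 0 with hc
  set d := A 1 1 with hd
  have hcd : 1 ≤ c ^ 2 - |c| * |d| + d ^ 2 := by
    rw [← sq_abs c, ← sq_abs d]
    by_contra! hlt
    have h0 := abs_nonneg c
    have h0' := abs_nonneg d
    have hc0 : |c| = 0 := by nlinarith [sq_nonneg (|c| - |d|), sq_nonneg (|c| + |d|)]
    have hd0 : |d| = 0 := by nlinarith [sq_nonneg (|c| - |d|), sq_nonneg (|c| + |d|)]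
    exact bottom_row_ne_zero A (abs_eq_zero.1 hc0) (abs_eq_zero.1 hd0)
  have hcd' : (1 : ℝ) ≤ (c : ℝ) ^ 2 - |(c : ℝ)| * |(d : ℝ)| + (d : ℝ) ^ 2 := by exact_mod_cast hcd
  have hx : -(|(c : ℝ)| * |(d : ℝ)|) ≤ 2 * c * d * z.re := by
    have : |2 * (c : ℝ) * d * z.re| ≤ |(c : ℝ)| * |(d : ℝ)| := by
      rw [← abs_mul, show 2 * (c : ℝ) * d * z.re = (c * d) * (2 * z.re) by ring, abs_mul]
      exact mul_le_of_le_one_right (abs_nonneg _) (abs_le.2 ⟨by linarith, by linarith⟩)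
    exact (abs_le.1 this).1
  nlinarith [mul_le_mul_of_nonneg_left h (sq_nonneg (c : ℝ))]

theorem im_smul_eq_of_lower_left_eq_zero {A : SL(2, ℤ)} (hc : A 1 0 = 0) (z : ℍ) :
    (A • z).im = z.im ∧ ∃ n : ℤ, (A • z).re = z.re + n := by
  obtain ⟨n, hn⟩ := ModularGroup.exists_eq_T_zpow_of_c_eq_zero hc
  rw [hn]
  exact ⟨ModularGroup.im_T_zpow_smul z n, n, ModularGroup.re_T_zpow_smul z n⟩

/-- Disjointness of horoballs: if `c ≠ 0` then `|c z + d|² ≥ (Im z)² > Im z`, which pushes the image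
below height `1`. -/
theorem lower_left_eq_zero_of_one_lt_im {A : SL(2, ℤ)} {z : ℍ} (hz : 1 < z.im)
    (hA : 1 < (A • z).im) : A 1 0 = 0 := by
  by_contra hc
  rw [im_smul_eq] at hA
  have hc' : (1 : ℝ) ≤ (A 1 0 : ℝ) ^ 2 := by
    have : 1 ≤ (A 1 0) ^ 2 := by have := sq_pos_of_ne_zero hc; omega
    exact_mod_cast this
  have hpos : z.im < ((A 1 0 : ℝ) * z.re + A 1 1) ^ 2 + ((A 1 0 : ℝ) * z.im) ^ 2 := by
    nlinarith [sq_nonneg ((A 1 0 : ℝ) * z.re + A 1 1), sq_nonneg z.im]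
  rw [lt_div_iff₀ (by linarith)] at hA
  linarith

/-! ### The compact core -/

theorem mem_fundDomain_iff {z : ℍ} : z ∈ fundDomain ↔
    0 ≤ z.re ∧ z.re ≤ 1 ∧ 1 ≤ z.re ^ 2 + z.im ^ 2 ∧ 1 ≤ (z.re - 1) ^ 2 + z.im ^ 2 := by
  have key (w : ℂ) : 1 ≤ ‖w‖ ↔ 1 ≤ w.re ^ 2 + w.im ^ 2 := by
    rw [← one_le_sq_iff₀ (norm_nonneg w), Complex.sq_norm, Complex.normSq_apply, sq, sq]
  simp [fundDomain, key]

theorem exists_proj_eq_mem_fundDomain (z : ℍ) : ∃ w ∈ fundDomain, proj w = proj z := by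
  obtain ⟨A, h1, h2⟩ := ModularGroup.exists_smul_mem_fd z
  rw [Complex.normSq_apply] at h1
  rw [abs_le] at h2
  simp only [UpperHalfPlane.coe_re, UpperHalfPlane.coe_im] at h1
  rcases le_total 0 (A • z).re with h | h
  · refine ⟨A • z, mem_fundDomain_iff.2 ⟨h, ?_, ?_, ?_⟩, proj_smul A z⟩ <;> nlinarith
  · refine ⟨ModularGroup.T • A • z, mem_fundDomain_iff.2 ?_, by rw [proj_smul, proj_smul]⟩
    rw [ModularGroup.re_T_smul, ModularGroup.im_T_smul]
    refine ⟨?_, ?_, ?_, ?_⟩ <;> nlinarith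

theorem im_smul_le_of_mem_fundDomain {z : ℍ} (hz : z ∈ fundDomain) (A : SL(2, ℤ)) :
    (A • z).im ≤ z.im := by
  obtain ⟨h0, h1, h2, h3⟩ := mem_fundDomain_iff.1 hz
  rcases le_total z.re (1 / 2) with h | h
  · exact im_smul_le_of_strip h2 (by linarith) h A
  · have := im_smul_le_of_strip (z := ModularGroup.T⁻¹ • z)
      (by rwa [ModularGroup.re_T_inv_smul, ModularGroup.im_T_inv_smul])
      (by rw [ModularGroup.re_T_inv_smul]; linarith)
      (by rw [ModularGroup.re_T_inv_smul]; linarith) (A * ModularGroup.T)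
    rwa [ModularGroup.im_T_inv_smul, smul_smul, mul_inv_cancel_right] at this

/-- Points of `fundDomain` have maximal height in their orbit, and every orbit meets `fundDomain`.
-/
theorem proj_mem_compactCore_iff {T₀ : ℝ} {z : ℍ} :
    proj z ∈ compactCore T₀ ↔ ∀ A : SL(2, ℤ), (A • z).im ≤ T₀ := by
  constructor
  · rintro ⟨w, ⟨hw, hwT⟩, h⟩ A
    obtain ⟨B, rfl⟩ := proj_eq_proj_iff.1 h.symm
    rw [smul_smul]
    exact (im_smul_le_of_mem_fundDomain hw _).trans hwT
  · intro h
    obtain ⟨w, hw, hwz⟩ := exists_proj_eq_mem_fundDomain z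
    obtain ⟨A, rfl⟩ := proj_eq_proj_iff.1 hwz
    exact ⟨_, ⟨hw, h A⟩, hwz⟩

theorem proj_notMem_compactCore_iff {T₀ : ℝ} {z : ℍ} :
    proj z ∉ compactCore T₀ ↔ ∃ A : SL(2, ℤ), T₀ < (A • z).im := by
  simp [proj_mem_compactCore_iff]

/-- A path that stays outside the compact core stays in a single horoball. -/
theorem exists_lt_im_smul_of_notMem_compactCore {T₀ : ℝ} (hT₀ : 1 ≤ T₀) {g : ℝ → ℍ}
    (hg : Continuous g) {R : ℝ} (h : ∀ t, R ≤ t → proj (g t) ∉ compactCore T₀) :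
    ∃ A : SL(2, ℤ), ∀ t, R ≤ t → T₀ < (A • g t).im := by
  obtain ⟨A, hA⟩ := proj_notMem_compactCore_iff.1 (h R le_rfl)
  have hopen (B : SL(2, ℤ)) : IsOpen {t | T₀ < (B • g t).im} :=
    isOpen_lt continuous_const
      (UpperHalfPlane.continuous_im.comp ((continuous_const_smul (B : GL (Fin 2) ℝ)).comp hg))
  refine ⟨A, fun t ht => ?_⟩
  have hsub : Set.Ici R ⊆ {t | T₀ < (A • g t).im} :=
    -- The second open set gathers the horoballs at the other cusps; a `B` with `(B * A⁻¹) 1 0 = 0`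
    -- gives the same heights as `A`. Connectedness of the ray leaves only the first set.
    isPreconnected_Ici.subset_left_of_subset_union (hopen A)
      (v := ⋃ B ∈ {B : SL(2, ℤ) | (B * A⁻¹) 1 0 ≠ 0}, {t | T₀ < (B • g t).im})
      (isOpen_biUnion fun B _ => hopen B)
      (by
        rw [Set.disjoint_left]
        intro s hs hs'
        simp only [Set.mem_iUnion] at hs'
        obtain ⟨B, hB, hBs⟩ := hs'
        refine hB (lower_left_eq_zero_of_one_lt_im (z := A • g s) (hT₀.trans_lt hs) ?_)
        rw [smul_smul, inv_mul_cancel_right]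
        exact hT₀.trans_lt hBs)
      (by
        intro s hs
        obtain ⟨B, hB⟩ := proj_notMem_compactCore_iff.1 (h s hs)
        by_cases hc : (B * A⁻¹) 1 0 = 0
        · left
          have := (im_smul_eq_of_lower_left_eq_zero hc (A • g s)).1
          rw [smul_smul, inv_mul_cancel_right] at this
          exact hB.trans_eq this
        · exact Or.inr (Set.mem_biUnion hc hB))
      ⟨R, Set.self_mem_Ici, hA⟩
  exact hsub ht

/-! ### Geodesics of the upper half-plane ending at `∞` -/

theorem vertLine_re (x t : ℝ) : (vertLine x t).re = x := rfl

theorem vertLine_im (x t : ℝ) : (vertLine x t).im = Real.exp (-t) := rfl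

/-- The right side is the Minkowski pairing of the hyperboloid vectors `((x² + y²) / y, 1 / y, x /
y)` of the two points. -/
theorem cosh_dist_eq (z w : ℍ) : Real.cosh (dist z w) =
    ((z.re ^ 2 + z.im ^ 2) / z.im * (1 / w.im) + 1 / z.im * ((w.re ^ 2 + w.im ^ 2) / w.im)) / 2
      - z.re / z.im * (w.re / w.im) := by
  have hz := z.im_ne_zero
  have hw := w.im_ne_zero
  rw [UpperHalfPlane.cosh_dist, Complex.dist_eq, Complex.sq_norm, Complex.normSq_apply]
  simp only [Complex.sub_re, Complex.sub_im, UpperHalfPlane.coe_re, UpperHalfPlane.coe_im]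
  field_simp
  ring

/-- An isotropic vector of the hyperboloid model orthogonal to a point of `ℍ` vanishes. -/
theorem eq_zero_of_isotropic_of_orthogonal {a b c x y : ℝ} (hy : y ≠ 0) (h : a * c - b * b = 0)
    (h' : (a * ((x ^ 2 + y ^ 2) / y) + c * (1 / y)) / 2 - b * (x / y) = 0) : a = 0 := by
  have h1 : a * (x ^ 2 + y ^ 2) + c - 2 * b * x = 0 := by
    field_simp at h'
    linarith
  have h2 : (a * x - b) ^ 2 + (a * y) ^ 2 = 0 := by linear_combination a * h1 - h
  have h3 : a * y = 0 := by nlinarith [sq_nonneg (a * x - b), sq_nonneg (a * y)]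
  exact (mul_eq_zero.1 h3).resolve_right hy

/-- On the hyperboloid, the point at time `t` is the `sinh`-combination of those at times `0` and
`1`. The pairwise distances show that the difference of the two sides is isotropic and orthogonal to
the point at time `0`, hence zero; only the coordinate `1 / y` is needed. -/
theorem inv_im_isometry {g : ℝ → ℍ} (hg : Isometry g) (t : ℝ) :
    1 / (g t).im = Real.sinh (1 - t) / Real.sinh 1 * (1 / (g 0).im)
      + Real.sinh t / Real.sinh 1 * (1 / (g 1).im) := by
  have hs : Real.sinh 1 ≠ 0 := (Real.sinh_pos_iff.2 one_pos).ne'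
  have hdist (s t : ℝ) : Real.cosh (t - s) = Real.cosh (dist (g s) (g t)) := by
    rw [hg.dist_eq, Real.dist_eq, Real.cosh_abs, ← Real.cosh_neg]; ring_nf
  simp only [cosh_dist_eq] at hdist
  have e1 : Real.sinh (1 - t) = Real.sinh 1 * Real.cosh t - Real.cosh 1 * Real.sinh t :=
    Real.sinh_sub 1 t
  have h00 := hdist 0 0
  have h11 := hdist 1 1
  have htt := hdist t t
  have h01 := hdist 0 1
  have h0t := hdist 0 t
  have h1t := hdist 1 t
  simp only [sub_zero, sub_self, Real.cosh_zero, Real.cosh_sub] at h00 h11 htt h01 h0t h1t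
  have hq1 := Real.cosh_sq 1
  have hqt := Real.cosh_sq t
  have hy := (g 0).im_ne_zero
  have hα : Real.sinh (1 - t) / Real.sinh 1 * Real.sinh 1
      = Real.sinh 1 * Real.cosh t - Real.cosh 1 * Real.sinh t := by
    rw [div_mul_cancel₀ _ hs, e1]
  have hβ : Real.sinh t / Real.sinh 1 * Real.sinh 1 = Real.sinh t := div_mul_cancel₀ _ hs
  generalize Real.sinh (1 - t) / Real.sinh 1 = α at *
  generalize Real.sinh t / Real.sinh 1 = β at *
  generalize Real.sinh 1 = S at *
  generalize Real.cosh 1 = K at *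
  generalize Real.sinh t = s at *
  generalize Real.cosh t = k at *
  subst hβ
  have hαk : α = k - K * β := mul_right_cancel₀ hs (by linear_combination hα)
  subst hαk
  rw [← sub_eq_zero]
  refine eq_zero_of_isotropic_of_orthogonal (x := (g 0).re) (y := (g 0).im)
    (b := (g t).re / (g t).im - ((k - K * β) * ((g 0).re / (g 0).im) + β * ((g 1).re / (g 1).im)))
    (c := ((g t).re ^ 2 + (g t).im ^ 2) / (g t).im
      - ((k - K * β) * (((g 0).re ^ 2 + (g 0).im ^ 2) / (g 0).im)
        + β * (((g 1).re ^ 2 + (g 1).im ^ 2) / (g 1).im))) hy ?_ ?_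
  · linear_combination -htt - (k - K * β) ^ 2 * h00 - β ^ 2 * h11 + 2 * (k - K * β) * h0t
      + 2 * β * h1t - 2 * (k - K * β) * β * h01 - hqt - β ^ 2 * hq1
  · linear_combination -h0t + (k - K * β) * h00 + β * h01

theorem exists_exp_inv_im {g : ℝ → ℍ} (hg : Isometry g) :
    ∃ A B : ℝ, ∀ t, 1 / (g t).im = A * Real.exp t + B * Real.exp (-t) := by
  refine ⟨(1 / (g 1).im - Real.exp (-1) * (1 / (g 0).im)) / (2 * Real.sinh 1),
    (Real.exp 1 * (1 / (g 0).im) - 1 / (g 1).im) / (2 * Real.sinh 1), fun t => ?_⟩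
  have hs : Real.sinh 1 ≠ 0 := (Real.sinh_pos_iff.2 one_pos).ne'
  rw [inv_im_isometry hg t, Real.sinh_eq (1 - t), Real.sinh_eq t, neg_sub, sub_eq_add_neg 1 t,
    sub_eq_add_neg t 1, Real.exp_add, Real.exp_add]
  field_simp
  ring

/-- The logarithm of the ratio of heights bounds the distance from below, with equality only on a
vertical line. -/
theorem re_eq_of_dist_eq {z w : ℍ} {s : ℝ} (h : dist z w = |s|) (him : w.im = Real.exp s * z.im) :
    w.re = z.re := by
  have hz := z.im_ne_zero
  have := cosh_dist_eq z w
  rw [h, Real.cosh_abs, him, Real.cosh_eq, Real.exp_neg] at this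
  have he := (Real.exp_pos s).ne'
  field_simp at this
  have h2 : (w.re - z.re) ^ 2 = 0 := by linear_combination -this
  exact sub_eq_zero.1 (pow_eq_zero_iff two_ne_zero |>.1 h2)

/-- A geodesic whose height stays bounded below in the past comes down vertically from `∞`. -/
theorem eq_vertLine_of_lt_im {g : ℝ → ℍ} (hg : Isometry g) {T R : ℝ} (hT : 0 < T)
    (h : ∀ t, t ≤ R → T < (g t).im) : ∃ x c : ℝ, ∀ t, g t = vertLine x (c + t) := by
  obtain ⟨A, B, hAB⟩ := exists_exp_inv_im hg
  have hpos (t : ℝ) : 0 < A * Real.exp t + B * Real.exp (-t) := hAB t ▸ one_div_pos.2 (g t).im_pos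
  have hexp : Filter.Tendsto (fun t : ℝ => A * Real.exp (-t)) Filter.atTop (nhds (A * 0)) :=
    (Real.tendsto_exp_neg_atTop_nhds_zero).const_mul A
  -- As `t → -∞`, `B < 0` would make `1 / Im` negative, and `B > 0` would make it exceed `1 / T`.
  have hB : B = 0 := by
    rcases lt_trichotomy B 0 with hB | hB | hB
    · have h1 := Filter.Tendsto.add_atBot hexp
        (Real.tendsto_exp_atTop.const_mul_atTop_of_neg hB)
      obtain ⟨t, ht⟩ := (h1.eventually_lt_atBot 0).exists
      have := hpos (-t)
      rw [neg_neg] at this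
      linarith
    · exact hB
    · have h1 := Filter.Tendsto.add_atTop hexp
        (Real.tendsto_exp_atTop.const_mul_atTop hB)
      obtain ⟨t, ht, ht'⟩ := ((h1.eventually_gt_atTop (1 / T)).and
        (Filter.eventually_ge_atTop (-R))).exists
      have h2 := hAB (-t)
      rw [neg_neg] at h2
      have h3 := one_div_lt_one_div_of_lt hT (h (-t) (by linarith))
      linarith
  subst hB
  have hA : 0 < A := by
    have := hpos 0
    simpa using this
  have him (t : ℝ) : (g t).im = Real.exp (-(Real.log A + t)) := by
    rw [Real.exp_neg, Real.exp_add, Real.exp_log hA]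
    have := hAB t
    rw [zero_mul, add_zero] at this
    rw [← this, one_div, inv_inv]
  refine ⟨(g 0).re, Real.log A, fun t => UpperHalfPlane.ext_re_im ?_ (him t)⟩
  refine (re_eq_of_dist_eq (z := g 0) (s := -t) ?_ ?_ : (g t).re = (g 0).re)
  · rw [hg.dist_eq, Real.dist_eq, zero_sub]
  · rw [him, him, ← Real.exp_add]
    ring_nf

/-! ### The rationals `GAll` -/

theorem eq_of_dvd_mul_add_one {q p y y' : ℤ} (h : q ∣ p * y + 1) (h' : q ∣ p * y' + 1)
    (hy : 0 ≤ y) (hyq : y < q) (hy' : 0 ≤ y') (hyq' : y' < q) : y = y' := by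
  have h1 : q ∣ y - y' := by
    have := dvd_sub (h'.mul_right y) (h.mul_right y')
    rwa [show (p * y' + 1) * y - (p * y + 1) * y' = y - y' by ring] at this
  exact sub_eq_zero.1 (Int.eq_zero_of_abs_lt_dvd h1 (abs_lt.2 ⟨by linarith, by linarith⟩))

theorem exists_dvd_mul_add_one {q p : ℤ} (hq : 0 < q) (h : IsCoprime p q) :
    ∃ y, 0 ≤ y ∧ y < q ∧ q ∣ p * y + 1 := by
  obtain ⟨a, b, hab⟩ := h
  refine ⟨(-a) % q, Int.emod_nonneg _ hq.ne', Int.emod_lt_of_pos _ hq, b - p * (-a / q), ?_⟩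
  have := Int.emod_add_mul_ediv (-a) q
  linear_combination p * this - hab

theorem isCoprime_of_dvd_mul_add_one {q p y : ℤ} (h : q ∣ p * y + 1) : IsCoprime p q := by
  obtain ⟨k, hk⟩ := h
  exact ⟨-y, k, by linear_combination -hk⟩

theorem modEq_neg_one_iff {q a : ℤ} : a ≡ -1 [ZMOD q] ↔ q ∣ a + 1 := by
  rw [Int.modEq_comm, Int.modEq_iff_dvd, sub_neg_eq_add]

theorem num_den_div {p q : ℤ} (hq : 0 < q) (h : IsCoprime p q) :
    ((p : ℚ) / q).num = p ∧ (((p : ℚ) / q).den : ℤ) = q :=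
  ⟨Rat.num_div_eq_of_coprime hq (Int.isCoprime_iff_gcd_eq_one.1 h),
    Rat.den_div_eq_of_coprime hq (Int.isCoprime_iff_gcd_eq_one.1 h)⟩

/-- Among the fractions `p / q` and `y / q` with `p y ≡ -1 (mod q)`, `w` is the smaller one. -/
def IsReduced (w : ℚ) : Prop :=
  0 ≤ w.num ∧ w.num < w.den ∧
    ∀ y : ℤ, 0 ≤ y → y < w.den → (w.den : ℤ) ∣ w.num * y + 1 → w.num ≤ y

theorem den_eq_and_isReduced_of_mem_G {q : ℕ} (hq : 1 ≤ q) {w : ℚ} (hw : w ∈ G q) :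
    w.den = q ∧ IsReduced w := by
  unfold G at hw
  split_ifs at hw with h1
  · rw [Set.mem_singleton_iff] at hw
    subst hw h1
    exact ⟨rfl, le_rfl, by norm_num, fun y hy _ _ => hy⟩
  · obtain ⟨p, hp, rfl⟩ := hw
    have hq0 : (0 : ℤ) < q := by exact_mod_cast hq
    -- `y` is the partner of `p`: the other member of the pair for `Cstar`, `p` itself for `S`.
    have main (y : ℕ) (hpq : p < q) (hpy : p ≤ y) (hyq : y < q) (hd : (q : ℤ) ∣ p * y + 1) :
        ((p : ℚ) / q).den = q ∧ IsReduced ((p : ℚ) / q) := by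
      obtain ⟨hn, hd'⟩ := num_den_div hq0 (isCoprime_of_dvd_mul_add_one hd)
      push_cast at hn hd'
      refine ⟨by exact_mod_cast hd', ?_⟩
      unfold IsReduced
      rw [hn, hd']
      refine ⟨by positivity, by exact_mod_cast hpq, fun z hz hzq hdz => ?_⟩
      rw [eq_of_dvd_mul_add_one hdz hd hz hzq (by positivity) (by exact_mod_cast hyq)]
      exact_mod_cast hpy
    rcases hp with ⟨p₁, hp₁, p₂, hp₂, -, hmod, rfl⟩ | ⟨-, hpq, hmod⟩
    · rw [modEq_neg_one_iff] at hmod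
      have h₁ := hp₁.1.2.1
      have h₂ := hp₂.1.2.1
      rcases le_total p₁ p₂ with h | h
      · rw [min_eq_left h] at main ⊢
        exact main p₂ h₁ h h₂ hmod
      · rw [min_eq_right h] at main ⊢
        exact main p₁ h₂ h h₁ (by rwa [mul_comm])
    · rw [modEq_neg_one_iff, sq] at hmod
      exact main p hpq le_rfl hpq hmod

theorem mem_GAll_of_isReduced {w : ℚ} (hw : IsReduced w) : w ∈ GAll := by
  obtain ⟨h0, h1, h⟩ := hw
  refine Set.mem_iUnion₂.2 ⟨w.den, w.pos, ?_⟩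
  unfold G
  split_ifs with hq
  · have : w.num = 0 := by rw [hq] at h1; push_cast at h1; omega
    exact Rat.zero_of_num_zero this
  · have hcop : IsCoprime w.num (w.den : ℤ) := Int.isCoprime_iff_gcd_eq_one.2 w.reduced
    obtain ⟨y, hy0, hyq, hd⟩ := exists_dvd_mul_add_one (by exact_mod_cast w.pos) hcop
    have hle := h y hy0 hyq hd
    have hwe : w = (w.num : ℚ) / w.den := (Rat.num_div_den w).symm
    generalize w.num = p at *
    have hq0 := w.pos
    generalize w.den = q at *
    lift p to ℕ using h0
    lift y to ℕ using hy0
    norm_cast at h1 hyq hle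
    have hunit (a b : ℕ) (hd : (q : ℤ) ∣ a * b + 1) : 1 ≤ a := by
      rcases Nat.eq_zero_or_pos a with rfl | h
      · refine absurd (Int.natCast_dvd_natCast.1 (by simpa using hd) : q ∣ 1) ?_
        rwa [Nat.dvd_one]
      · exact h
    have hI (a b : ℕ) (haq : a < q) (hd : (q : ℤ) ∣ a * b + 1) : a ∈ I q :=
      ⟨hunit a b hd, haq, Nat.isCoprime_iff_coprime.1 (isCoprime_of_dvd_mul_add_one hd)⟩
    have hd' : (q : ℤ) ∣ y * p + 1 := by rwa [mul_comm]
    refine ⟨p, ?_, by simpa using hwe⟩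
    rcases eq_or_ne p y with rfl | hne
    · exact Or.inr ⟨hunit p p hd, h1, by rwa [modEq_neg_one_iff, sq]⟩
    · exact Or.inl ⟨p, ⟨hI p y h1 hd, y, hI y p hyq hd', modEq_neg_one_iff.2 hd, hne⟩,
        y, ⟨hI y p hyq hd', p, hI p y h1 hd, modEq_neg_one_iff.2 hd', hne.symm⟩,
        hne, modEq_neg_one_iff.2 hd, (min_eq_left hle).symm⟩

theorem isReduced_of_mem_GAll {w : ℚ} (hw : w ∈ GAll) : IsReduced w := by
  obtain ⟨q, hq, hwq⟩ := Set.mem_iUnion₂.1 hw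
  exact (den_eq_and_isReduced_of_mem_G hq hwq).2

/-! ### The geodesics with end points `∞` and `w` -/

theorem proj_vertLine_add_int (x : ℝ) (n : ℤ) (t : ℝ) :
    proj (vertLine (x + n) t) = proj (vertLine x t) := by
  rw [← proj_smul (ModularGroup.T ^ n) (vertLine x t)]
  congr 1
  refine UpperHalfPlane.ext_re_im ?_ ?_
  · rw [ModularGroup.re_T_zpow_smul]; rfl
  · rw [ModularGroup.im_T_zpow_smul]; rfl

theorem proj_vertLine_div {p y : ℤ} {q : ℕ} (hq : 0 < q) (h : (q : ℤ) ∣ p * y + 1) (t : ℝ) :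
    proj (vertLine (p / q) t) = proj (vertLine (y / q) (2 * Real.log q - t)) := by
  obtain ⟨k, hk⟩ := h
  -- This matrix sends `p/q` to `∞` and `∞` to `y/q`, and the height `h` on the first line to `1 /
  -- (q² h)` on the second.
  let A : SL(2, ℤ) := ⟨!![y, -k; q, -p], by
    rw [Matrix.det_fin_two_of]; linear_combination -hk⟩
  rw [← proj_smul A]
  congr 1
  apply UpperHalfPlane.ext
  rw [UpperHalfPlane.coe_specialLinearGroup_apply]
  have hq' : (q : ℂ) ≠ 0 := by exact_mod_cast hq.ne'
  have hqr : (0 : ℝ) < q := by exact_mod_cast hq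
  have hcoe (x s : ℝ) : (vertLine x s : ℂ) = x + Real.exp (-s) * Complex.I :=
    Complex.mk_eq_add_mul_I _ _
  have hexp : Real.exp (-(2 * Real.log q - t)) = 1 / ((q : ℝ) ^ 2 * Real.exp (-t)) := by
    rw [neg_sub, Real.exp_sub, two_mul, Real.exp_add, Real.exp_log hqr, Real.exp_neg]
    field_simp
  rw [hcoe, hcoe, hexp]
  have he : Complex.exp (-(t : ℂ)) ≠ 0 := Complex.exp_ne_zero _
  have hk' : (p : ℂ) * y + 1 = q * k := by exact_mod_cast hk
  simp only [A, Matrix.of_apply, Matrix.cons_val', Matrix.cons_val_zero,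
    Matrix.cons_val_one, Matrix.cons_val_fin_one, algebraMap_int_eq, eq_intCast]
  push_cast
  generalize (Complex.exp (-(t : ℂ))) = e at *
  have hden : (q : ℂ) * (p / q + e * Complex.I) + -p = q * e * Complex.I := by
    field_simp
    ring
  rw [hden, div_eq_iff (by simp [hq', he])]
  field_simp
  linear_combination hk' - Complex.I_sq

theorem geodesicTo_eq_mk_iff {x : ℝ} {γ : ParamGeodesic} :
    geodesicTo x = Quotient.mk trackSetoid γ ↔
      ∃ c : ℝ, (∀ t, γ.1 t = proj (vertLine x (c + t))) ∨
        (∀ t, γ.1 t = proj (vertLine x (c - t))) :=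
  Quotient.eq

theorem geodesicTo_eq_iff {x x' : ℝ} : geodesicTo x = geodesicTo x' ↔
    ∃ c : ℝ, (∀ t, proj (vertLine x' t) = proj (vertLine x (c + t))) ∨
      (∀ t, proj (vertLine x' t) = proj (vertLine x (c - t))) :=
  Quotient.eq

theorem geodesicTo_div {p y : ℤ} {q : ℕ} (hq : 0 < q) (h : (q : ℤ) ∣ p * y + 1) :
    geodesicTo (p / q) = geodesicTo (y / q) :=
  geodesicTo_eq_iff.2 ⟨2 * Real.log q, Or.inr fun t => by
    rw [proj_vertLine_div hq h, sub_sub_cancel]⟩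

theorem hasSojournTime_geodesicTo_div {T₀ : ℝ} (hT₀ : 1 ≤ T₀) {p y : ℤ} {q : ℕ} (hq : 0 < q)
    (h : (q : ℤ) ∣ p * y + 1) :
    (geodesicTo (p / q)).HasSojournTime T₀ (2 * Real.log (q * T₀)) := by
  have hT : 0 < T₀ := by linarith
  have hqr : (q : ℝ) ≠ 0 := by exact_mod_cast hq.ne'
  have hbound (x t : ℝ) (ht : proj (vertLine x t) ∈ compactCore T₀) : -Real.log T₀ ≤ t := by
    have := proj_mem_compactCore_iff.1 ht 1
    rw [one_smul, vertLine_im, ← Real.le_log_iff_exp_le hT] at this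
    linarith
  -- At height exactly `T₀ ≥ 1`, no matrix can raise the point further.
  have hmem (x : ℝ) : proj (vertLine x (-Real.log T₀)) ∈ compactCore T₀ := by
    rw [proj_mem_compactCore_iff]
    intro A
    have him : (vertLine x (-Real.log T₀)).im = T₀ := by
      rw [vertLine_im, neg_neg, Real.exp_log hT]
    by_cases hc : A 1 0 = 0
    · rw [(im_smul_eq_of_lower_left_eq_zero hc _).1, him]
    · have hc' : (1 : ℝ) ≤ (A 1 0 : ℝ) ^ 2 := by
        have : 1 ≤ (A 1 0) ^ 2 := by have := sq_pos_of_ne_zero hc; omega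
        exact_mod_cast this
      rw [im_smul_eq, him]
      refine div_le_self hT.le ?_
      have h1 : 1 ≤ (A 1 0 : ℝ) ^ 2 * T₀ ^ 2 := one_le_mul_of_one_le_of_one_le hc' (one_le_pow₀ hT₀)
      rw [mul_pow]
      exact h1.trans (le_add_of_nonneg_left (sq_nonneg _))
  refine ⟨-Real.log T₀, 2 * Real.log q + Real.log T₀, ⟨hmem _, fun t ht => hbound _ t ht⟩,
    ⟨?_, fun t ht => ?_⟩, ?_⟩
  · change proj (vertLine (p / q) (2 * Real.log q + Real.log T₀)) ∈ compactCore T₀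
    rw [proj_vertLine_div hq h, sub_add_cancel_left]
    exact hmem _
  · change proj (vertLine (p / q) t) ∈ compactCore T₀ at ht
    rw [proj_vertLine_div hq h] at ht
    linarith [hbound _ _ ht]
  · rw [Real.log_mul hqr hT.ne']
    ring

theorem Geodesic.HasSojournTime.isScattering {T₀ l : ℝ} {γ : Geodesic}
    (h : γ.HasSojournTime T₀ l) : γ.IsScattering T₀ := by
  induction γ using Quotient.inductionOn with | h γ => ?_
  obtain ⟨a, b, ⟨-, ha⟩, ⟨-, hb⟩, -⟩ := h
  refine ⟨|a| + |b| + 1, fun t ht hmem => ?_⟩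
  have h1 := ha hmem
  have h2 := hb hmem
  have h3 := abs_le.2 (⟨by linarith [neg_abs_le a, abs_nonneg b], by
    linarith [le_abs_self b, abs_nonneg a]⟩ : -(|a| + |b|) ≤ t ∧ t ≤ |a| + |b|)
  linarith

theorem hasSojournTime_geodesicTo {T₀ : ℝ} (hT₀ : 1 ≤ T₀) (w : ℚ) :
    (geodesicTo w).HasSojournTime T₀ (2 * Real.log (w.den * T₀)) := by
  obtain ⟨y, -, -, hd⟩ := exists_dvd_mul_add_one (by exact_mod_cast w.pos)
    (Int.isCoprime_iff_gcd_eq_one.2 w.reduced : IsCoprime w.num (w.den : ℤ))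
  have := hasSojournTime_geodesicTo_div hT₀ w.pos hd
  rwa [← Rat.cast_def] at this

/-- Early enough, both lines are above height `1`, so a matrix relating them must be an integer
translation. -/
theorem exists_eq_add_int_of_proj_vertLine {x x' c : ℝ}
    (h : ∀ t, proj (vertLine x' t) = proj (vertLine x (c + t))) : ∃ n : ℤ, x' = x + n := by
  obtain ⟨t, h1, h2⟩ : ∃ t : ℝ, t < 0 ∧ c + t < 0 :=
    ⟨-|c| - 1, by linarith [abs_nonneg c], by linarith [le_abs_self c]⟩
  obtain ⟨A, hA⟩ := proj_eq_proj_iff.1 (h t)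
  have hc : A 1 0 = 0 := lower_left_eq_zero_of_one_lt_im (z := vertLine x (c + t))
    (by rw [vertLine_im]; exact Real.one_lt_exp_iff.2 (by linarith))
    (by rw [hA, vertLine_im]; exact Real.one_lt_exp_iff.2 (by linarith))
  obtain ⟨-, n, hn⟩ := im_smul_eq_of_lower_left_eq_zero hc (vertLine x (c + t))
  exact ⟨n, by rwa [hA, vertLine_re, vertLine_re] at hn⟩

theorem rat_eq_of_cast_eq_add_int {w w' : ℚ} (h0 : 0 ≤ w) (h1 : w < 1) (h0' : 0 ≤ w')
    (h1' : w' < 1) {n : ℤ} (h : (w' : ℝ) = w + n) : w' = w := by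
  have h' : w' = w + n := by exact_mod_cast h
  have hn : n = 0 := by
    have h2 : (n : ℚ) < 1 := by linarith
    have h3 : (-1 : ℚ) < n := by linarith
    have h2' : n < 1 := by exact_mod_cast h2
    have h3' : -1 < n := by exact_mod_cast h3
    omega
  rw [h', hn, Int.cast_zero, add_zero]

theorem IsReduced.nonneg_and_lt_one {w : ℚ} (hw : IsReduced w) : 0 ≤ w ∧ w < 1 :=
  ⟨Rat.num_nonneg.1 hw.1, Rat.num_lt_denom_iff.1 hw.2.1⟩

theorem injOn_geodesicTo : Set.InjOn (fun w : ℚ => geodesicTo (w : ℝ)) GAll := by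
  intro w hw w' hw' h
  replace hw := isReduced_of_mem_GAll hw
  replace hw' := isReduced_of_mem_GAll hw'
  obtain ⟨h0, h1⟩ := hw.nonneg_and_lt_one
  obtain ⟨h0', h1'⟩ := hw'.nonneg_and_lt_one
  obtain ⟨c, hc | hc⟩ := geodesicTo_eq_iff.1 h
  · obtain ⟨n, hn⟩ := exists_eq_add_int_of_proj_vertLine hc
    exact (rat_eq_of_cast_eq_add_int h0 h1 h0' h1' hn).symm
  -- Orientation reversed: `w'` is the partner `y / q` of `w`, and minimality of each of the two
  -- forces equality.
  · have hq : (0 : ℤ) < w.den := by exact_mod_cast w.pos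
    have hqQ : (0 : ℚ) < w.den := by exact_mod_cast w.pos
    obtain ⟨y, hy0, hyq, hd⟩ := exists_dvd_mul_add_one hq
      (Int.isCoprime_iff_gcd_eq_one.2 w.reduced : IsCoprime w.num (w.den : ℤ))
    obtain ⟨n, hn⟩ := exists_eq_add_int_of_proj_vertLine
      (x := y / w.den) (x' := w') (c := 2 * Real.log w.den - c) fun t => by
        rw [hc, Rat.cast_def w, proj_vertLine_div w.pos hd]
        congr 2
        ring
    have hw'y : w' = (y : ℚ) / w.den := by
      refine rat_eq_of_cast_eq_add_int (by positivity) ?_ h0' h1' (n := n) (by push_cast; exact hn)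
      rw [div_lt_one hqQ]
      exact_mod_cast hyq
    have hd' : (w.den : ℤ) ∣ y * w.num + 1 := by rwa [mul_comm]
    obtain ⟨hnum, hden⟩ := num_den_div hq (isCoprime_of_dvd_mul_add_one hd')
    rw [Int.cast_natCast, ← hw'y] at hnum hden
    have hle := hw.2.2 y hy0 hyq hd
    have hle' := hw'.2.2 w.num hw.1 (by rw [hden]; exact hw.2.1) (by rwa [hnum, hden])
    rw [hnum] at hle'
    exact Rat.ext (by omega) (by exact_mod_cast hden.symm)

theorem exists_isReduced_geodesicTo_eq (w : ℚ) :
    ∃ v : ℚ, IsReduced v ∧ geodesicTo (v : ℝ) = geodesicTo (w : ℝ) := by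
  have hq : (0 : ℤ) < w.den := by exact_mod_cast w.pos
  have hcop : IsCoprime w.num (w.den : ℤ) := Int.isCoprime_iff_gcd_eq_one.2 w.reduced
  obtain ⟨y, hy0, hyq, hd⟩ := exists_dvd_mul_add_one hq hcop
  have hcop' : IsCoprime y (w.den : ℤ) := isCoprime_of_dvd_mul_add_one (by rwa [mul_comm])
  -- The partner of the partner: `p` is the residue of `w.num` in `[0, q)`, where `q = w.den`.
  obtain ⟨p, hp0, hpq, hdp⟩ := exists_dvd_mul_add_one hq hcop'
  have hyw : geodesicTo (w : ℝ) = geodesicTo (y / w.den) := by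
    rw [Rat.cast_def w, geodesicTo_div w.pos hd]
  have key (a b : ℤ) (hab : a ≤ b) (ha : 0 ≤ a) (hb : b < w.den) (h : (w.den : ℤ) ∣ a * b + 1) :
      IsReduced ((a : ℚ) / w.den) := by
    obtain ⟨hn, hd'⟩ := num_den_div hq (isCoprime_of_dvd_mul_add_one h)
    rw [Int.cast_natCast] at hn hd'
    unfold IsReduced
    rw [hn, hd']
    refine ⟨ha, by omega, fun z hz hzq hdz => ?_⟩
    rwa [eq_of_dvd_mul_add_one hdz h hz hzq (by omega) hb]
  rcases le_total y p with h | h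
  · refine ⟨_, key y p h hy0 hpq hdp, ?_⟩
    push_cast
    exact hyw.symm
  · refine ⟨_, key p y h hp0 hyq (by rwa [mul_comm]), ?_⟩
    push_cast
    rw [hyw, geodesicTo_div w.pos hdp]

/-- Towards the foot `x` the height `Im z / |c z + d|²` tends to `0` unless `c x + d = 0` with `c ≠
0`. -/
theorem exists_rat_eq_of_lt_im_smul {T x R : ℝ} (hT : 0 < T) {A : SL(2, ℤ)}
    (h : ∀ t, R ≤ t → T < (A • vertLine x t).im) : ∃ w : ℚ, x = w := by
  have hexp := Real.tendsto_exp_neg_atTop_nhds_zero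
  by_cases hc : A 1 0 = 0
  · obtain ⟨t, ht, ht'⟩ := ((hexp.eventually_lt_const hT).and
      (Filter.eventually_ge_atTop R)).exists
    have := h t ht'
    rw [(im_smul_eq_of_lower_left_eq_zero hc _).1, vertLine_im] at this
    linarith
  · have hd : (A 1 0 : ℝ) * x + A 1 1 = 0 := by
      by_contra hne
      have hpos := mul_pos hT (sq_pos_of_ne_zero hne)
      obtain ⟨t, ht, ht'⟩ := ((hexp.eventually_lt_const hpos).and
        (Filter.eventually_ge_atTop R)).exists
      have := h t ht'
      rw [im_smul_eq, vertLine_im, vertLine_re, lt_div_iff₀ (by positivity)] at this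
      nlinarith [sq_nonneg ((A 1 0 : ℝ) * Real.exp (-t))]
    refine ⟨-(A 1 1 : ℚ) / (A 1 0 : ℚ), ?_⟩
    have hc' : (A 1 0 : ℝ) ≠ 0 := by exact_mod_cast hc
    push_cast
    rw [eq_div_iff hc']
    linarith

theorem isometry_modular_smul (A : SL(2, ℤ)) : Isometry (fun z : ℍ => A • z) := by
  have h (z : ℍ) : A • z = (A.map (Int.castRingHom ℝ)) • z := by
    apply UpperHalfPlane.ext
    rw [UpperHalfPlane.coe_specialLinearGroup_apply, UpperHalfPlane.coe_specialLinearGroup_apply]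
    simp
  simp only [h]
  exact isometry_smul ℍ (A.map (Int.castRingHom ℝ))

theorem exists_rat_geodesicTo_eq {T₀ : ℝ} (hT₀ : 1 ≤ T₀) {γ : Geodesic}
    (hγ : γ.IsScattering T₀) : ∃ w : ℚ, geodesicTo (w : ℝ) = γ := by
  have hT : 0 < T₀ := by linarith
  induction γ using Quotient.inductionOn with | h γ => ?_
  have hsc := hγ
  obtain ⟨g, hg, hγg⟩ := γ.2
  obtain ⟨R, hR⟩ := hγ
  -- The past end, run backwards in time; `A` moves its horoball to `∞`.
  obtain ⟨A, hA⟩ := exists_lt_im_smul_of_notMem_compactCore hT₀ (g := fun t => g (-t)) (R := R)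
    (hg.continuous.comp continuous_neg) fun t ht => by
      rw [← hγg]
      exact hR _ (by rw [abs_neg]; exact ht.trans (le_abs_self t))
  obtain ⟨x, c, hx⟩ := eq_vertLine_of_lt_im (g := fun t => A • g t)
    ((isometry_modular_smul A).comp hg) hT (R := -R) fun t ht => by
      have := hA (-t) (by linarith)
      rwa [neg_neg] at this
  have hγx : geodesicTo x = Quotient.mk trackSetoid γ :=
    geodesicTo_eq_mk_iff.2 ⟨c, Or.inl fun t => by rw [hγg, ← hx t, proj_smul]⟩
  rw [← hγx] at hsc ⊢
  obtain ⟨R', hR'⟩ := hsc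
  obtain ⟨B, hB⟩ := exists_lt_im_smul_of_notMem_compactCore hT₀
    (isometry_vertLine x).continuous fun t ht => hR' t (ht.trans (le_abs_self t))
  obtain ⟨w, rfl⟩ := exists_rat_eq_of_lt_im_smul hT hB
  exact ⟨w, rfl⟩

end ScatGeod

theorem mainTheorem2 (T₀ : ℝ) (hT₀ : 1 ≤ T₀) :
    Set.BijOn (fun w : ℚ => ScatGeod.geodesicTo (w : ℝ))
      ScatGeod.GAll (ScatGeod.scatteringGeodesics T₀) ∧
    ∀ q : ℕ, 1 ≤ q → ∀ w ∈ ScatGeod.G q,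
      (ScatGeod.geodesicTo (w : ℝ)).HasSojournTime T₀ (2 * Real.log (q * T₀)) := by
  refine ⟨⟨fun w _ => (ScatGeod.hasSojournTime_geodesicTo hT₀ w).isScattering,
    ScatGeod.injOn_geodesicTo, fun γ hγ => ?_⟩, fun q hq w hw => ?_⟩
  · obtain ⟨w, rfl⟩ := ScatGeod.exists_rat_geodesicTo_eq hT₀ hγ
    obtain ⟨v, hv, hvw⟩ := ScatGeod.exists_isReduced_geodesicTo_eq w
    exact ⟨v, ScatGeod.mem_GAll_of_isReduced hv, hvw⟩
  · rw [← (ScatGeod.den_eq_and_isReduced_of_mem_G hq hw).1]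
    exact ScatGeod.hasSojournTime_geodesicTo hT₀ w
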